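/- Write $\mathbb C^*=\mathbb C\setminus\{0\}$. A transcendental self-map of $\mathbb C^*$ is a holomorphic map $f:\mathbb C^*\to\mathbb C^*$ for which both $0$ and $\infty$ are essential singularities. For a transcendental (that is, non-polynomial) entire function or a transcendental self-map $f$ of $\mathbb C^*$, with domain $S=\mathbb C$ or $S=\mathbb C^*$ respectively, let $\operatorname{sing}(f^{-1})$ be the set of the critical values $f(c)$, $c\in S$, $f'(c)=0$, together with the finite asymptotic values of $f$. Here $a$ is an asymptotic value of $f$ if there is an injective continuous curve $\gamma:(0,+\infty)\to S$ such that, as $t\to+\infty$, $\gamma(t)$ tends to an essential singularity of $f$ (namely $\infty$ if $S=\mathbb C$; $0$ or $\infty$ if $S=\mathbb C^*$) and $f(\gamma(t))\to a$; it is called finite if $a\ne\infty$ when $S=\mathbb C$, and if $a\notin\{0,\infty\}$ when $S=\mathbb C^*$. Let $$\mathcal B=\{f \text{ transcendental entire}:\ \operatorname{sing}(f^{-1})\text{ is bounded}\},$$ $$\mathcal B^*=\{f\text{ transcendental self-map of }\mathbb C^*:\ \operatorname{sing}(f^{-1})\text{ is bounded away from }0\text{ and }\infty\}.$$ **Theorem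 1.2.** Let $g$ and $h$ be entire functions in the class $\mathcal B$. Then the function $f(z)=\exp\bigl(g(z)+h(1/z)\bigr)$, $z\in\mathbb C^*$, is in the class $\mathcal B^*$. -/

import Mathlib

namespace BoundedType

open Filter Topology

/-- The punctured plane `ℂ* = ℂ \ {0}`. -/
def puncturedPlane : Set ℂ := {0}ᶜ

/-- `z₀` is an essential singularity of `f`: an isolated singularity that is neither removable nor
a pole. (For `f` holomorphic in a punctured neighbourhood of `z₀`, being meromorphic at `z₀` means
exactly that the singularity is removable or a pole; the value `f z₀` is irrelevant.) -/
def IsEssentialSingularity (f : ℂ → ℂ) (z₀ : ℂ) : Prop :=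
  (∀ᶠ z in 𝓝[≠] z₀, DifferentiableAt ℂ f z) ∧ ¬ MeromorphicAt f z₀

/-- `∞` is an essential singularity of `f`. -/
def IsEssentialSingularityAtInfty (f : ℂ → ℂ) : Prop :=
  IsEssentialSingularity (fun z => f z⁻¹) 0

/-- A transcendental entire function: an entire function that is not a polynomial. -/
def IsTranscendentalEntire (f : ℂ → ℂ) : Prop :=
  Differentiable ℂ f ∧ ¬ ∃ p : Polynomial ℂ, ∀ z, f z = p.eval z

/-- A transcendental self-map of `ℂ*`: a holomorphic map `ℂ* → ℂ*` for which both `0` and `∞` are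
essential singularities. Only the values of `f` on `ℂ*` matter. -/
def IsTranscendentalSelfMap (f : ℂ → ℂ) : Prop :=
  DifferentiableOn ℂ f puncturedPlane ∧ Set.MapsTo f puncturedPlane puncturedPlane ∧
    IsEssentialSingularity f 0 ∧ IsEssentialSingularityAtInfty f

/-- The critical values of `f : S → ℂ`, for `S` open: the values `f c` with `c ∈ S`, `f' c = 0`. -/
def criticalValues (S : Set ℂ) (f : ℂ → ℂ) : Set ℂ :=
  {v | ∃ c ∈ S, deriv f c = 0 ∧ f c = v}

/-- The asymptotic values in `ℂ` of `f : S → ℂ` along injective curves `γ : (0, ∞) → S` that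
converge along the filter `l` (`𝓝 0` for curves to `0`, `cobounded ℂ` for curves to `∞`). -/
def asymptoticValues (S : Set ℂ) (f : ℂ → ℂ) (l : Filter ℂ) : Set ℂ :=
  {a | ∃ γ : ℝ → ℂ, ContinuousOn γ (Set.Ioi 0) ∧ Set.InjOn γ (Set.Ioi 0) ∧
    Set.MapsTo γ (Set.Ioi 0) S ∧ Tendsto γ atTop l ∧ Tendsto (fun t => f (γ t)) atTop (𝓝 a)}

/-- `sing(f⁻¹)` for a transcendental entire function: the critical values and the finite
asymptotic values, the only essential singularity being `∞`. -/
def singEntire (f : ℂ → ℂ) : Set ℂ :=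
  criticalValues Set.univ f ∪ asymptoticValues Set.univ f (Bornology.cobounded ℂ)

/-- `sing(f⁻¹)` for a transcendental self-map of `ℂ*`: the critical values and the asymptotic
values other than `0` and `∞`, along curves to `0` or to `∞`. -/
def singPunctured (f : ℂ → ℂ) : Set ℂ :=
  criticalValues puncturedPlane f ∪
    ((asymptoticValues puncturedPlane f (𝓝 0) ∪
      asymptoticValues puncturedPlane f (Bornology.cobounded ℂ)) \ {0})

/-- The Eremenko–Lyubich class `𝓑`. -/
def classB : Set (ℂ → ℂ) :=
  {f | IsTranscendentalEntire f ∧ Bornology.IsBounded (singEntire f)}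

/-- The class `𝓑*`: transcendental self-maps of `ℂ*` whose singular values are bounded away from
`0` and `∞`. -/
def classBStar : Set (ℂ → ℂ) :=
  {f | IsTranscendentalSelfMap f ∧
    ∃ r R : ℝ, 0 < r ∧ ∀ v ∈ singPunctured f, r ≤ ‖v‖ ∧ ‖v‖ ≤ R}

end BoundedType

/-!
Write `f = exp ∘ G` on `ℂ*` with `G(z) = g(z) + h(1/z)`. Everything is symmetric under `z ↦ 1/z`,
which exchanges `g` and `h`, so only the behaviour near `∞` has to be understood. Since
`|exp b| = exp (Re b)`, it is enough that every singular value of `f` other than `0` and `∞` is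
`exp b` with `b` in a fixed bounded set (`exists_bound_log_singular_values`).

*Asymptotic values.* If `f → a ≠ 0` along a curve to `∞`, then `G` converges along that curve to
some `b` with `exp b = a` (`exists_tendsto_of_tendsto_exp`), so `b - h(0)` is an asymptotic value
of `g`.

*Critical values.* At a critical point `c` with `|c| ≥ 1` one has `c² g'(c) = h'(1/c)`, which is
bounded. On the other hand, if `R` bounds both `sing(g⁻¹)` and `|g|` on the unit disc, then
`2 |z² g'(z)| ≥ |g(z)| - R` wherever `|g(z)| > R` (`norm_sub_le_two_mul_sq_mul_norm_deriv`); this is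
a weak form of the Eremenko–Lyubich expansion estimate that requires neither the logarithmic change
of variable nor Koebe's theorem. Indeed the disc of radius `|g(z)| - R` around `g(z)` is free of
singular values, hence carries an inverse branch `φ` of `g` (`exists_inverse_branch`). The branch
avoids the unit disc, and the Schwarz lemma applies to `1/φ`. Consequently `g(c)`, and with it
`G(c)`, is bounded.

The inverse branch is obtained by lifting the radii of the disc through `g`, restricted to its
non-critical points. A lift that cannot be continued up to some point either accumulates at a
critical point or escapes to `∞`; it is injective because the radius is, and so it would produce a
singular value in the disc. The lifted endpoints depend continuously on the radius by homotopy
lifting.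

*Essential singularities.* If `f` were meromorphic at `0`, so would be its logarithmic derivative
`g'(z) - h'(1/z)/z²`, and then `h'` and `h` would be polynomials.
-/

namespace BoundedType

open Filter Topology Set

/-! ### Path lifting through local homeomorphisms -/

/-- A lift of `γ` over `[0, a]` whose endpoint lies in the domain of a local inverse defined along
`γ` on `[a, s]` extends to a lift over `[0, s]`. -/
theorem exists_lift_Icc_of_openPartialHomeomorph {E X : Type*} [TopologicalSpace E]
    [TopologicalSpace X] {p : E → X} {γ : ℝ → X} (hγ : Continuous γ) {e₀ : E} {a s : ℝ}
    (ha : 0 ≤ a) (q : OpenPartialHomeomorph E X) (hq : p = q)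
    {Γ : ℝ → E} (hΓ : ContinuousOn Γ (Icc 0 a)) (hΓ₀ : Γ 0 = e₀)
    (hpΓ : ∀ t ∈ Icc 0 a, p (Γ t) = γ t) (hΓa : Γ a ∈ q.source)
    (hγq : ∀ t ∈ Icc a s, γ t ∈ q.target) :
    ∃ Γ' : ℝ → E, ContinuousOn Γ' (Icc 0 s) ∧ Γ' 0 = e₀ ∧ ∀ t ∈ Icc 0 s, p (Γ' t) = γ t := by
  classical
  have hcont : ContinuousOn (fun t => q.symm (γ t)) (Icc a s) :=
    q.continuousOn_symm.comp hγ.continuousOn hγq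
  have hglue : q.symm (γ a) = Γ a := by
    rw [← hpΓ a ⟨ha, le_rfl⟩, hq, q.left_inv hΓa]
  refine ⟨fun t => if t ≤ a then Γ t else q.symm (γ t), ?_, by simp [ha, hΓ₀], ?_⟩
  · have h₁ : ContinuousOn (fun t => if t ≤ a then Γ t else q.symm (γ t)) (Icc 0 a) :=
      hΓ.congr fun t ht => if_pos ht.2
    have h₂ : ContinuousOn (fun t => if t ≤ a then Γ t else q.symm (γ t)) (Icc a s) := by
      refine hcont.congr fun t ht => ?_
      rcases ht.1.eq_or_lt with rfl | h
      · simp [hglue]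
      · simp [not_le.2 h]
    refine (h₁.union_of_isClosed h₂ isClosed_Icc isClosed_Icc).mono fun t ht => ?_
    rcases le_total t a with h | h
    exacts [Or.inl ⟨ht.1, h⟩, Or.inr ⟨h, ht.2⟩]
  · intro t ht
    rcases le_or_gt t a with h | h
    · simpa [h] using hpΓ t ⟨ht.1, h⟩
    · simp only [not_le.2 h, if_false]
      rw [hq]
      exact q.right_inv (hγq t ⟨h.le, ht.2⟩)

/-- Path lifting through a local homeomorphism: it suffices that every lift over a half-open
interval `[0, s)` accumulates somewhere as its parameter tends to `s`. -/
theorem exists_lift_of_mapClusterPt {E X : Type*} [TopologicalSpace E] [T2Space E]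
    [TopologicalSpace X] {p : E → X} (hp : IsLocalHomeomorph p) {γ : ℝ → X} (hγ : Continuous γ)
    {e₀ : E} (he₀ : p e₀ = γ 0)
    (H : ∀ s ∈ Ioc (0 : ℝ) 1, ∀ Γ : ℝ → E, ContinuousOn Γ (Ico 0 s) →
      (∀ t ∈ Ico 0 s, p (Γ t) = γ t) → ∃ e, p e = γ s ∧ MapClusterPt e (𝓝[<] s) Γ) :
    ∃ Γ : ℝ → E, ContinuousOn Γ (Icc 0 1) ∧ Γ 0 = e₀ ∧ ∀ t ∈ Icc (0 : ℝ) 1, p (Γ t) = γ t := by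
  let P : ℝ → Prop := fun s => ∃ Γ : ℝ → E, ContinuousOn Γ (Icc 0 s) ∧ Γ 0 = e₀ ∧
    ∀ t ∈ Icc 0 s, p (Γ t) = γ t
  have hmono : ∀ s s', s ≤ s' → P s' → P s := by
    rintro s s' h ⟨Γ, h₁, h₂, h₃⟩
    exact ⟨Γ, h₁.mono (Icc_subset_Icc_right h), h₂, fun t ht => h₃ t ⟨ht.1, ht.2.trans h⟩⟩
  have hzero : P 0 := by
    refine ⟨fun _ => e₀, continuousOn_const, rfl, fun t ht => ?_⟩
    rw [he₀, le_antisymm ht.2 ht.1]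
  -- Openness: a lift over `[0, s]` can be continued beyond `s`.
  have hopen : ∀ s, 0 ≤ s → P s → ∃ s' > s, P s' := by
    rintro s hs ⟨Γ, h₁, h₂, h₃⟩
    obtain ⟨q, hqs, hpq⟩ := hp (Γ s)
    have hmem : γ ⁻¹' q.target ∈ 𝓝 s := by
      refine hγ.continuousAt.preimage_mem_nhds (q.open_target.mem_nhds ?_)
      rw [← h₃ s ⟨hs, le_rfl⟩, hpq]
      exact q.map_source hqs
    obtain ⟨ε, hε, hball⟩ := Metric.mem_nhds_iff.1 hmem
    refine ⟨s + ε / 2, by linarith, exists_lift_Icc_of_openPartialHomeomorph hγ hs q hpq h₁ h₂ h₃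
      hqs fun t ht => hball ?_⟩
    rw [Metric.mem_ball, Real.dist_eq, abs_lt]
    constructor <;> linarith [ht.1, ht.2]
  -- Closedness: the lifts over `[0, t]` for `t < s` fit together by uniqueness, and the resulting
  -- lift over `[0, s)` enters the domain of a local inverse around its cluster point.
  have hclosed : ∀ s ∈ Ioc (0 : ℝ) 1, (∀ t ∈ Ico 0 s, P t) → P s := by
    intro s hs hP
    have : Nonempty E := ⟨e₀⟩
    choose! Γ h₁ h₂ h₃ using hP
    have hagree : ∀ a ∈ Ico 0 s, EqOn (fun t => Γ t t) (Γ a) (Icc 0 a) := by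
      intro a ha t ht
      have hts : t ∈ Ico 0 s := ⟨ht.1, ht.2.trans_lt ha.2⟩
      refine (T2Space.isSeparatedMap p).eqOn_of_comp_eqOn hp.isLocallyInjective
        (isPreconnected_Icc (a := (0 : ℝ)) (b := t)) (h₁ t hts)
        ((h₁ a ha).mono (Icc_subset_Icc_right ht.2)) (fun u hu => ?_)
        (left_mem_Icc.2 ht.1) ?_ (right_mem_Icc.2 ht.1)
      · simp only [Function.comp_apply]
        rw [h₃ t hts u hu, h₃ a ha u ⟨hu.1, hu.2.trans ht.2⟩]
      · rw [h₂ t hts, h₂ a ha]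
    have hlift : ∀ t ∈ Ico 0 s, p (Γ t t) = γ t := fun t ht => h₃ t ht t ⟨ht.1, le_rfl⟩
    have hcont : ContinuousOn (fun t => Γ t t) (Ico 0 s) := by
      intro t ht
      obtain ⟨a, hta, has⟩ := exists_between ht.2
      have := ((h₁ a ⟨ht.1.trans hta.le, has⟩).congr (hagree a ⟨ht.1.trans hta.le, has⟩)) t
        ⟨ht.1, hta.le⟩
      refine this.mono_of_mem_nhdsWithin ?_
      filter_upwards [self_mem_nhdsWithin, mem_nhdsWithin_of_mem_nhds (Iio_mem_nhds hta)] with u hu hua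
      exact ⟨hu.1, le_of_lt hua⟩
    obtain ⟨e, hpe, he⟩ := H s hs _ hcont hlift
    obtain ⟨q, hqs, hpq⟩ := hp e
    have hmem : γ ⁻¹' q.target ∈ 𝓝 s := by
      refine hγ.continuousAt.preimage_mem_nhds (q.open_target.mem_nhds ?_)
      rw [← hpe, hpq]
      exact q.map_source hqs
    obtain ⟨ε, hε, hball⟩ := Metric.mem_nhds_iff.1 hmem
    have hev : ∀ᶠ t in 𝓝[<] s, t ∈ Ioo (max 0 (s - ε)) s :=
      Ioo_mem_nhdsLT (max_lt hs.1 (by linarith))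
    obtain ⟨a, haq, ha⟩ := ((he.frequently (q.open_source.mem_nhds hqs)).and_eventually hev).exists
    rw [mem_Ioo, max_lt_iff] at ha
    have ha' : a ∈ Ico 0 s := ⟨ha.1.1.le, ha.2⟩
    refine exists_lift_Icc_of_openPartialHomeomorph hγ ha.1.1.le q hpq (h₁ a ha') (h₂ a ha')
      (h₃ a ha') haq fun t ht => hball ?_
    rw [Metric.mem_ball, Real.dist_eq, abs_lt]
    constructor <;> linarith [ht.1, ht.2, ha.1.2]
  by_contra hcon
  let S : Set ℝ := {s | s ∈ Icc (0 : ℝ) 1 ∧ P s}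
  have hS₀ : (0 : ℝ) ∈ S := ⟨⟨le_rfl, zero_le_one⟩, hzero⟩
  have hbdd : BddAbove S := ⟨1, fun s hs => hs.1.2⟩
  have hσ₀ : 0 ≤ sSup S := le_csSup hbdd hS₀
  have hσ₁ : sSup S ≤ 1 := csSup_le ⟨0, hS₀⟩ fun s hs => hs.1.2
  have hPσ : P (sSup S) := by
    rcases hσ₀.eq_or_lt with h | h
    · rw [← h]; exact hzero
    · refine hclosed _ ⟨h, hσ₁⟩ fun t ht => ?_
      obtain ⟨s, hs, hts⟩ := exists_lt_of_lt_csSup ⟨0, hS₀⟩ ht.2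
      exact hmono t s hts.le hs.2
  rcases hσ₁.eq_or_lt with h | h
  · exact hcon (h ▸ hPσ)
  · obtain ⟨s', hs', hPs'⟩ := hopen _ hσ₀ hPσ
    have : min s' 1 ∈ S := ⟨⟨le_min (hσ₀.trans hs'.le) zero_le_one, min_le_right _ _⟩,
      hmono _ _ (min_le_left _ _) hPs'⟩
    exact absurd (le_csSup hbdd this) (not_le.2 (lt_min hs' h))

/-! ### Inverse branches of entire functions -/

/-- Away from its critical points, an entire function is a local homeomorphism. -/
theorem isLocalHomeomorph_of_differentiable {g : ℂ → ℂ} (hg : Differentiable ℂ g) :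
    IsLocalHomeomorph fun z : {z : ℂ // deriv g z ≠ 0} => g z := by
  have hopen : IsOpen {z : ℂ | deriv g z ≠ 0} :=
    isOpen_ne_fun hg.deriv.continuous continuous_const
  have hlocal : IsLocalHomeomorphOn g {z : ℂ | deriv g z ≠ 0} := by
    refine IsLocalHomeomorphOn.mk g _ fun z hz => ?_
    have hd := ((hg.analyticAt z).hasStrictDerivAt).hasStrictFDerivAt_equiv hz
    exact ⟨hd.toOpenPartialHomeomorph g, hd.mem_toOpenPartialHomeomorph_source, fun _ _ => rfl⟩
  rw [isLocalHomeomorph_iff_isLocalHomeomorphOn_univ]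
  exact hlocal.comp hopen.isOpenEmbedding_subtypeVal.isLocalHomeomorph.isLocalHomeomorphOn
    fun z _ => z.2

/-- A partial lift of a straight segment through an entire function accumulates at a non-critical
point, unless its endpoint is a singular value: the lift of an injective curve is injective, so
that a lift escaping to `∞` would exhibit an asymptotic value. -/
theorem exists_mapClusterPt_of_lift_segment {g : ℂ → ℂ} (hg : Differentiable ℂ g) {w v : ℂ}
    (hv : v ≠ 0) {s : ℝ} (hs : 0 < s) (hsing : w + s * v ∉ singEntire g)
    {Γ : ℝ → {z : ℂ // deriv g z ≠ 0}} (hΓ : ContinuousOn Γ (Ico 0 s))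
    (hgΓ : ∀ t ∈ Ico 0 s, g (Γ t) = w + t * v) :
    ∃ e : {z : ℂ // deriv g z ≠ 0}, g e = w + s * v ∧ MapClusterPt e (𝓝[<] s) Γ := by
  have hlim : Tendsto (fun t => g (Γ t)) (𝓝[<] s) (𝓝 (w + s * v)) := by
    have h : Tendsto (fun t : ℝ => w + t * v) (𝓝[<] s) (𝓝 (w + s * v)) :=
      (Continuous.tendsto (by fun_prop) s).mono_left nhdsWithin_le_nhds
    refine h.congr' ?_
    filter_upwards [Ioo_mem_nhdsLT hs] with t ht using (hgΓ t ⟨ht.1.le, ht.2⟩).symm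
  by_cases hinf : Tendsto (fun t => (Γ t : ℂ)) (𝓝[<] s) (Bornology.cobounded ℂ)
  · refine absurd (Or.inr ?_) hsing
    have hpos : ∀ t ∈ Ioi (0 : ℝ), 1 + t ≠ 0 := fun t ht => by
      have : (0 : ℝ) < t := ht
      positivity
    have hmaps : MapsTo (fun t : ℝ => s * (t / (1 + t))) (Ioi 0) (Ico 0 s) := by
      intro t ht
      have ht : 0 < t := ht
      refine ⟨by positivity, ?_⟩
      have : t / (1 + t) < 1 := (div_lt_one (by positivity)).2 (by linarith)
      nlinarith
    have hparam : Tendsto (fun t : ℝ => s * (t / (1 + t))) atTop (𝓝[<] s) := by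
      refine tendsto_nhdsWithin_iff.2 ⟨?_, ?_⟩
      · have h : Tendsto (fun t : ℝ => s * (1 - (1 + t)⁻¹)) atTop (𝓝 (s * (1 - 0))) :=
          ((tendsto_inv_atTop_zero.comp (tendsto_atTop_add_const_left _ 1 tendsto_id)).const_sub
            1).const_mul s
        simp only [sub_zero, mul_one] at h
        refine h.congr' ?_
        filter_upwards [Ioi_mem_atTop 0] with t ht
        have := hpos t ht
        field_simp
        ring
      · filter_upwards [Ioi_mem_atTop 0] with t ht using (hmaps ht).2
    refine ⟨fun t => Γ (s * (t / (1 + t))), ?_, ?_, fun _ _ => mem_univ _, hinf.comp hparam,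
      hlim.comp hparam⟩
    · refine (continuous_subtype_val.comp_continuousOn hΓ).comp ?_ hmaps
      exact continuousOn_const.mul (continuousOn_id.div (by fun_prop) hpos)
    · intro t ht u hu htu
      have h : w + ((s * (t / (1 + t)) : ℝ) : ℂ) * v = w + ((s * (u / (1 + u)) : ℝ) : ℂ) * v := by
        rw [← hgΓ _ (hmaps ht), ← hgΓ _ (hmaps hu)]
        exact congrArg g htu
      have h' := Complex.ofReal_injective (mul_right_cancel₀ hv (add_left_cancel h))
      have h'' := mul_left_cancel₀ hs.ne' h'
      rw [div_eq_div_iff (hpos t ht) (hpos u hu)] at h''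
      linarith
  · rw [← tendsto_norm_atTop_iff_cobounded, tendsto_atTop] at hinf
    push Not at hinf
    obtain ⟨M, hM⟩ := hinf
    obtain ⟨z, -, hz⟩ := (isCompact_closedBall (0 : ℂ) M).exists_mapClusterPt_of_frequently
      (f := fun t => (Γ t : ℂ)) (hM.mono fun t ht => by simpa using ht.le)
    have hgz : g z = w + s * v := by
      have h := hz.continuousAt_comp (hg z).continuousAt
      have : (𝓝 (g z) ⊓ map (g ∘ fun t => (Γ t : ℂ)) (𝓝[<] s)).NeBot := h
      exact tendsto_nhds_unique' this (tendsto_id.mono_left inf_le_left)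
        (tendsto_id.mono_left (inf_le_right.trans hlim))
    have hcrit : deriv g z ≠ 0 := fun h => hsing (Or.inl ⟨z, mem_univ _, h, hgz⟩)
    refine ⟨⟨z, hcrit⟩, hgz, ?_⟩
    rw [mapClusterPt_iff_frequently] at hz ⊢
    intro U hU
    rw [nhds_subtype_eq_comap, mem_comap] at hU
    obtain ⟨V, hV, hVU⟩ := hU
    exact (hz V hV).mono fun t ht => hVU ht

/-- An entire function has a holomorphic inverse branch on every disc free of singular values. -/
theorem exists_inverse_branch {g : ℂ → ℂ} (hg : Differentiable ℂ g) {z₀ : ℂ} {r : ℝ} (hr : 0 < r)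
    (hsing : Disjoint (Metric.ball (g z₀) r) (singEntire g)) :
    ∃ φ : ℂ → ℂ, φ (g z₀) = z₀ ∧ ∀ w ∈ Metric.ball (g z₀) r,
      g (φ w) = w ∧ HasDerivAt φ (deriv g (φ w))⁻¹ w := by
  classical
  have hz₀ : deriv g z₀ ≠ 0 := fun h =>
    disjoint_left.1 hsing (Metric.mem_ball_self hr) (Or.inl ⟨z₀, mem_univ _, h, rfl⟩)
  let p : {z : ℂ // deriv g z ≠ 0} → ℂ := fun z => g z
  have hp : IsLocalHomeomorph p := isLocalHomeomorph_of_differentiable hg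
  -- Lift every radius of the disc.
  have hlift : ∀ w : Metric.ball (g z₀) r, ∃ Γ : ℝ → {z : ℂ // deriv g z ≠ 0},
      ContinuousOn Γ (Icc 0 1) ∧ Γ 0 = ⟨z₀, hz₀⟩ ∧
        ((w : ℂ) = g z₀ → ∀ t, Γ t = ⟨z₀, hz₀⟩) ∧
        ∀ t ∈ Icc (0 : ℝ) 1, p (Γ t) = g z₀ + t * (w - g z₀) := by
    intro w
    by_cases hw : (w : ℂ) = g z₀
    · exact ⟨fun _ => ⟨z₀, hz₀⟩, continuousOn_const, rfl, fun _ _ => rfl, fun t _ => by simp [hw, p]⟩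
    · obtain ⟨Γ, h₁, h₂, h₃⟩ := exists_lift_of_mapClusterPt hp
        (γ := fun t : ℝ => g z₀ + t * (w - g z₀)) (by fun_prop) (e₀ := ⟨z₀, hz₀⟩) (by simp [p])
        fun s hs Γ hΓ hpΓ => exists_mapClusterPt_of_lift_segment hg (sub_ne_zero.2 hw) hs.1
          (fun hmem => disjoint_left.1 hsing (by
            have hw' := w.2
            rw [mem_ball_iff_norm] at hw' ⊢
            rw [add_sub_cancel_left, norm_mul, Complex.norm_real, Real.norm_of_nonneg hs.1.le]
            exact (mul_le_of_le_one_left (norm_nonneg _) hs.2).trans_lt hw') hmem) hΓ hpΓ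
      exact ⟨Γ, h₁, h₂, fun h => absurd h hw, h₃⟩
  choose Γ h₁ h₂ h₃ h₄ using hlift
  -- The endpoints of the lifted radii depend continuously on the point of the disc.
  have hcont : Continuous fun ta : unitInterval × Metric.ball (g z₀) r => Γ ta.2 ta.1 := by
    refine hp.continuous_lift (T2Space.isSeparatedMap p)
      ⟨fun ta : unitInterval × Metric.ball (g z₀) r =>
        g z₀ + ((ta.1 : ℝ) : ℂ) * (ta.2 - g z₀), by fun_prop⟩ ?_ ?_ ?_
    · ext ⟨t, w⟩
      exact h₄ w t t.2
    · refine (continuous_const (y := (⟨z₀, hz₀⟩ : {z : ℂ // deriv g z ≠ 0}))).congr fun w => ?_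
      exact (h₂ w).symm
    · intro w
      exact (h₁ w).comp_continuous continuous_subtype_val fun t => t.2
  have hend : Continuous fun w : Metric.ball (g z₀) r => (Γ w 1 : ℂ) :=
    continuous_subtype_val.comp (hcont.comp (Continuous.prodMk_right (1 : unitInterval)))
  let φ : ℂ → ℂ := fun w => if hw : w ∈ Metric.ball (g z₀) r then Γ ⟨w, hw⟩ 1 else 0
  have hφ : ∀ w (hw : w ∈ Metric.ball (g z₀) r), φ w = Γ ⟨w, hw⟩ 1 := fun w hw => dif_pos hw
  have hφcont : ContinuousOn φ (Metric.ball (g z₀) r) := by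
    rw [continuousOn_iff_continuous_domRestrict]
    refine hend.congr fun w => ?_
    simp [hφ w w.2]
  have hinv : ∀ w ∈ Metric.ball (g z₀) r, g (φ w) = w := by
    intro w hw
    rw [hφ w hw]
    have := h₄ ⟨w, hw⟩ 1 ⟨zero_le_one, le_rfl⟩
    simpa [p] using this
  refine ⟨φ, ?_, fun w hw => ⟨hinv w hw, ?_⟩⟩
  · rw [hφ _ (Metric.mem_ball_self hr), h₃ _ rfl]
  · refine HasDerivAt.of_local_left_inverse (hφcont.continuousAt (Metric.isOpen_ball.mem_nhds hw))
      (hg (φ w)).hasDerivAt ?_ ?_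
    · rw [hφ w hw]
      exact (Γ ⟨w, hw⟩ 1).2
    · filter_upwards [Metric.isOpen_ball.mem_nhds hw] with y hy using hinv y hy

/-- A lower bound for `|z² g'(z)|` where `|g|` is large. The inverse branch `φ` of `g` on the disc
of radius `|g(z)| - R` around `g(z)` omits the unit disc, so that `1/φ` is bounded by `1`, and the
Schwarz lemma bounds its derivative. -/
theorem norm_sub_le_two_mul_sq_mul_norm_deriv {g : ℂ → ℂ} (hg : Differentiable ℂ g) {R : ℝ}
    (hsing : ∀ v ∈ singEntire g, ‖v‖ ≤ R) (hdisc : ∀ z : ℂ, ‖z‖ ≤ 1 → ‖g z‖ ≤ R) {z : ℂ}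
    (hz : R < ‖g z‖) : ‖g z‖ - R ≤ 2 * ‖z‖ ^ 2 * ‖deriv g z‖ := by
  have hr : 0 < ‖g z‖ - R := sub_pos.2 hz
  have hlarge : ∀ w ∈ Metric.ball (g z) (‖g z‖ - R), R < ‖w‖ := by
    intro w hw
    rw [mem_ball_iff_norm'] at hw
    linarith [norm_sub_norm_le (g z) w]
  obtain ⟨φ, hφ₀, hφ⟩ := exists_inverse_branch hg hr
    (disjoint_left.2 fun w hw hw' => (hlarge w hw).not_ge (hsing w hw'))
  have hφnorm : ∀ w ∈ Metric.ball (g z) (‖g z‖ - R), 1 < ‖φ w‖ := by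
    intro w hw
    by_contra! h
    exact (hlarge w hw).not_ge ((hφ w hw).1 ▸ hdisc _ h)
  have hinvnorm : ∀ w ∈ Metric.ball (g z) (‖g z‖ - R), ‖(φ w)⁻¹‖ ≤ 1 := fun w hw => by
    rw [norm_inv]
    exact inv_le_one_of_one_le₀ (hφnorm w hw).le
  have hφne : ∀ w ∈ Metric.ball (g z) (‖g z‖ - R), φ w ≠ 0 := fun w hw h => by
    have := hφnorm w hw
    simp [h] at this
    linarith
  have hself := Metric.mem_ball_self (x := g z) hr
  have hschwarz : ‖deriv (fun w => (φ w)⁻¹) (g z)‖ ≤ 2 / (‖g z‖ - R) := by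
    refine Complex.norm_deriv_le_div_of_mapsTo_ball (fun w hw =>
      ((hφ w hw).2.differentiableAt.inv (hφne w hw)).differentiableWithinAt) (fun w hw => ?_) hr
    rw [mem_closedBall_iff_norm]
    linarith [norm_sub_le (φ w)⁻¹ (φ (g z))⁻¹, hinvnorm w hw, hinvnorm _ hself]
  have hderiv := (hφ _ hself).2.inv (hφne _ hself)
  have hz₀ : z ≠ 0 := hφ₀ ▸ hφne _ hself
  have hz₁ : deriv g z ≠ 0 := fun h =>
    hz.not_ge (hsing _ (Or.inl ⟨z, mem_univ _, h, rfl⟩))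
  rw [show (fun w => (φ w)⁻¹) = φ⁻¹ from rfl, hderiv.deriv, hφ₀, norm_div, norm_neg, norm_inv,
    norm_pow] at hschwarz
  have h₀ : 0 < ‖z‖ := norm_pos_iff.2 hz₀
  have h₁ : 0 < ‖deriv g z‖ := norm_pos_iff.2 hz₁
  rw [div_le_div_iff₀ (by positivity) hr, inv_mul_le_iff₀ h₁] at hschwarz
  linarith

/-! ### Essential singularities -/

/-- An entire function whose Taylor coefficients at `0` vanish from some order on is a
polynomial. -/
theorem exists_polynomial_of_iteratedDeriv_eq_zero {k : ℂ → ℂ} (hk : Differentiable ℂ k) {n : ℕ}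
    (h : ∀ m, n < m → iteratedDeriv m k 0 = 0) : ∃ p : Polynomial ℂ, ∀ z, k z = p.eval z := by
  refine ⟨∑ m ∈ Finset.range (n + 1),
    Polynomial.C ((m.factorial : ℂ)⁻¹ * iteratedDeriv m k 0) * Polynomial.X ^ m, fun z => ?_⟩
  rw [← Complex.taylorSeries_eq_of_entire' 0 z hk, tsum_eq_sum (s := Finset.range (n + 1))]
  · simp [Polynomial.eval_finsetSum]
  · intro m hm
    rw [h m (by simpa using hm)]
    simp

/-- If an entire function has at most a pole at `∞`, then its Taylor coefficients at `0` vanish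
from some order on, by Cauchy's estimates. -/
theorem exists_iteratedDeriv_eq_zero_of_meromorphicAt {k : ℂ → ℂ} (hk : Differentiable ℂ k)
    (h : MeromorphicAt (fun z => k z⁻¹) 0) : ∃ n : ℕ, ∀ m, n < m → iteratedDeriv m k 0 = 0 := by
  obtain ⟨n, hn⟩ := h
  refine ⟨n, fun m hm => ?_⟩
  obtain ⟨C, hC⟩ := (hn.continuousAt.norm.isBoundedUnder_le)
  rw [eventually_map] at hC
  obtain ⟨ε, hε, hball⟩ := Metric.eventually_nhds_iff.1 hC
  have hbound : ∀ R : ℝ, 0 < R → R⁻¹ < ε → ∀ z ∈ Metric.sphere (0 : ℂ) R, ‖k z‖ ≤ C * R ^ n := by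
    intro R hR hRε z hz
    rw [mem_sphere_zero_iff_norm] at hz
    have := @hball z⁻¹ (by rw [dist_zero_right, norm_inv, hz]; exact hRε)
    simp only [sub_zero, inv_inv, norm_pow, norm_inv, hz, smul_eq_mul, norm_mul] at this
    rw [inv_pow, inv_mul_le_iff₀ (by positivity)] at this
    linarith
  have hcauchy : ∀ᶠ R : ℝ in atTop,
      ‖iteratedDeriv m k 0‖ ≤ m.factorial * C * (R⁻¹) ^ (m - n) := by
    filter_upwards [Ioi_mem_atTop 0, tendsto_inv_atTop_zero.eventually (gt_mem_nhds hε)]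
      with R hR hRε
    have hR : 0 < R := hR
    refine (Complex.norm_iteratedDeriv_le_of_forall_mem_sphere_norm_le m hR hk.diffContOnCl
      (hbound R hR hRε)).trans_eq ?_
    obtain ⟨d, rfl⟩ := Nat.exists_eq_add_of_lt hm
    rw [show n + d + 1 - n = d + 1 by omega,
      show R ^ (n + d + 1) = R ^ n * R ^ (d + 1) by ring, inv_pow]
    field_simp
  have hlim : Tendsto (fun R : ℝ => m.factorial * C * (R⁻¹) ^ (m - n)) atTop (𝓝 0) := by
    have := (tendsto_inv_atTop_zero (𝕜 := ℝ)).pow (m - n) |>.const_mul (m.factorial * C)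
    rwa [zero_pow (by omega), mul_zero] at this
  exact norm_le_zero_iff.1 (ge_of_tendsto hlim hcauchy)

/-- The derivative of the exponent `g(z) + h(1/z)`. -/
theorem hasDerivAt_add_comp_inv {g h : ℂ → ℂ} (hg : Differentiable ℂ g) (hh : Differentiable ℂ h)
    {z : ℂ} (hz : z ≠ 0) :
    HasDerivAt (fun z => g z + h z⁻¹) (deriv g z - deriv h z⁻¹ / z ^ 2) z := by
  have := (hg z).hasDerivAt.add ((hh z⁻¹).hasDerivAt.comp z (hasDerivAt_inv hz))
  convert! this using 1
  field_simp
  ring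

/-- If `h` is transcendental, then `0` is an essential singularity of `exp (g(z) + h(1/z))`: the
logarithmic derivative of this function determines `h'(1/z)`. -/
theorem isEssentialSingularity_exp_add_comp_inv {g h : ℂ → ℂ} (hg : Differentiable ℂ g)
    (hh : IsTranscendentalEntire h) :
    IsEssentialSingularity (fun z => Complex.exp (g z + h z⁻¹)) 0 := by
  refine ⟨?_, fun hmer => hh.2 ?_⟩
  · filter_upwards [self_mem_nhdsWithin] with z hz
    exact (hasDerivAt_add_comp_inv hg hh.1 hz).differentiableAt.cexp
  · have hmer' : MeromorphicAt (fun z => deriv h z⁻¹) 0 := by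
      have hid : MeromorphicAt (fun z : ℂ => z) 0 := MeromorphicAt.id 0
      refine (((hg.deriv.analyticAt 0).meromorphicAt.sub hmer.logDeriv).mul (hid.pow 2)).congr ?_
      filter_upwards [self_mem_nhdsWithin] with z hz
      have hz : z ≠ 0 := hz
      have hd := (hasDerivAt_add_comp_inv hg hh.1 hz).cexp
      simp only [Pi.mul_apply, Pi.sub_apply, Pi.pow_apply, logDeriv_apply]
      rw [hd.deriv, mul_div_cancel_left₀ _ (Complex.exp_ne_zero _)]
      field_simp
      ring
    obtain ⟨n, hn⟩ := exists_iteratedDeriv_eq_zero_of_meromorphicAt hh.1.deriv hmer'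
    refine exists_polynomial_of_iteratedDeriv_eq_zero hh.1 (n := n + 1) fun m hm => ?_
    obtain ⟨m, rfl⟩ : ∃ j, m = j + 1 := ⟨m - 1, by omega⟩
    rw [iteratedDeriv_succ']
    exact hn m (by omega)

/-! ### Singular values -/

/-- A continuous curve whose exponential converges to a nonzero limit converges to a logarithm of
this limit. -/
theorem exists_tendsto_of_tendsto_exp {k : ℝ → ℂ} (hk : ContinuousOn k (Ioi 0)) {a : ℂ}
    (ha : a ≠ 0) (h : Tendsto (fun t => Complex.exp (k t)) atTop (𝓝 a)) :
    ∃ b, Complex.exp b = a ∧ Tendsto k atTop (𝓝 b) := by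
  have hdiv : Tendsto (fun t => Complex.exp (k t) / a) atTop (𝓝 1) := by
    simpa [ha] using h.div_const a
  obtain ⟨T, hT⟩ := eventually_atTop.1
    ((hdiv.eventually (Complex.isOpen_slitPlane.mem_nhds Complex.one_mem_slitPlane)).and
      (Ioi_mem_atTop 0))
  let c : ℝ → ℂ := fun t => k t - Complex.log (Complex.exp (k t) / a)
  have hk' : ContinuousOn k (Ici T) := hk.mono fun t ht => (hT t ht).2
  have hc : ContinuousOn c (Ici T) :=
    hk'.sub ((hk'.cexp.div_const a).clog fun t ht => (hT t ht).1)
  have hexp : ∀ t, Complex.exp (c t) = a := by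
    intro t
    rw [Complex.exp_sub, Complex.exp_log (div_ne_zero (Complex.exp_ne_zero _) ha)]
    field_simp [Complex.exp_ne_zero]
  have hconst : ∀ t ∈ Ici T, c t = c T := fun t ht =>
    (T2Space.isSeparatedMap _).constOn_of_comp
      Complex.isCoveringMap_exp.isLocalHomeomorph.isLocallyInjective isPreconnected_Ici hc
      (fun t _ u _ => Subtype.ext ((hexp t).trans (hexp u).symm)) ht self_mem_Ici
  refine ⟨c T, hexp T, ?_⟩
  have hlog : Tendsto (fun t => c T + Complex.log (Complex.exp (k t) / a)) atTop (𝓝 (c T)) := by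
    simpa using (hdiv.clog Complex.one_mem_slitPlane).const_add (c T)
  refine hlog.congr' ?_
  filter_upwards [Ici_mem_atTop T] with t ht
  rw [← hconst t ht, sub_add_cancel]

/-- The singular values of `exp (g(z) + h(1/z))` whose critical points lie outside the unit disc
or whose asymptotic curves tend to `∞` are `exp b` with `b` bounded. -/
theorem exists_bound_log_singular_values {g h : ℂ → ℂ} (hg : g ∈ classB)
    (hh : Differentiable ℂ h) :
    ∃ B : ℝ, (∀ z : ℂ, 1 ≤ ‖z‖ → deriv (fun z => g z + h z⁻¹) z = 0 → ‖g z + h z⁻¹‖ ≤ B) ∧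
      ∀ a ∈ asymptoticValues puncturedPlane (fun z => Complex.exp (g z + h z⁻¹))
        (Bornology.cobounded ℂ), a ≠ 0 → ∃ b, Complex.exp b = a ∧ ‖b‖ ≤ B := by
  obtain ⟨⟨hgd, -⟩, hsing⟩ := hg
  obtain ⟨R₁, hR₁⟩ := hsing.exists_norm_le
  have hcompact := isCompact_closedBall (0 : ℂ) 1
  obtain ⟨R₂, hR₂⟩ := hcompact.exists_bound_of_continuousOn hgd.continuous.continuousOn
  obtain ⟨M, hM⟩ := hcompact.exists_bound_of_continuousOn hh.continuous.continuousOn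
  obtain ⟨N, hN⟩ := hcompact.exists_bound_of_continuousOn hh.deriv.continuous.continuousOn
  simp only [mem_closedBall_zero_iff] at hR₂ hM hN
  have hN₀ : 0 ≤ N := (norm_nonneg _).trans (hN 0 (by simp))
  refine ⟨max R₁ R₂ + 2 * N + M, fun z hz hcrit => ?_, ?_⟩
  · have hz₀ : z ≠ 0 := norm_pos_iff.1 (zero_lt_one.trans_le hz)
    have hzinv : ‖z⁻¹‖ ≤ 1 := by
      rw [norm_inv]
      exact inv_le_one_of_one_le₀ hz
    have hgz : ‖g z‖ ≤ max R₁ R₂ + 2 * N := by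
      rcases le_or_gt ‖g z‖ (max R₁ R₂) with hle | hlt
      · linarith
      · have hest := norm_sub_le_two_mul_sq_mul_norm_deriv hgd
          (fun v hv => (hR₁ v hv).trans (le_max_left _ _))
          (fun w hw => (hR₂ w hw).trans (le_max_right _ _)) hlt
        rw [(hasDerivAt_add_comp_inv hgd hh hz₀).deriv, sub_eq_zero] at hcrit
        have hpos : 0 < ‖z‖ := norm_pos_iff.2 hz₀
        rw [hcrit, norm_div, norm_pow, mul_assoc, mul_div_cancel₀ _ (by positivity)] at hest
        linarith [hN _ hzinv]
    exact (norm_add_le _ _).trans (add_le_add hgz (hM _ hzinv))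
  · rintro a ⟨γ, hγc, hγi, hγm, hγ, hfγ⟩ ha
    have hγne : ∀ t ∈ Ioi (0 : ℝ), γ t ≠ 0 := fun t ht => hγm ht
    have hcont : ContinuousOn (fun t => g (γ t) + h (γ t)⁻¹) (Ioi 0) :=
      (hgd.continuous.comp_continuousOn hγc).add
        (hh.continuous.comp_continuousOn (hγc.inv₀ hγne))
    obtain ⟨b, hb, hlim⟩ := exists_tendsto_of_tendsto_exp hcont ha hfγ
    have hhlim : Tendsto (fun t => h (γ t)⁻¹) atTop (𝓝 (h 0)) :=
      (hh.continuous.tendsto 0).comp (tendsto_inv₀_cobounded.comp hγ)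
    have hglim : Tendsto (fun t => g (γ t)) atTop (𝓝 (b - h 0)) := by
      simpa using hlim.sub hhlim
    have hasym : ‖b - h 0‖ ≤ R₁ :=
      hR₁ _ (Or.inr ⟨γ, hγc, hγi, fun _ _ => mem_univ _, hγ, hglim⟩)
    refine ⟨b, hb, ?_⟩
    linarith [norm_le_norm_sub_add b (h 0), hM 0 (by simp), le_max_left R₁ R₂]

/-- Inversion `z ↦ 1/z` takes asymptotic values along curves to `0` to asymptotic values along
curves to `∞`. -/
theorem asymptoticValues_nhds_zero_subset (f : ℂ → ℂ) :
    asymptoticValues puncturedPlane f (𝓝 0) ⊆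
      asymptoticValues puncturedPlane (fun z => f z⁻¹) (Bornology.cobounded ℂ) := by
  rintro a ⟨γ, hγc, hγi, hγm, hγ, hfγ⟩
  refine ⟨fun t => (γ t)⁻¹, hγc.inv₀ hγm, fun t ht u hu htu => hγi ht hu (inv_injective htu),
    fun t ht => inv_ne_zero (hγm ht), ?_, by simpa using hfγ⟩
  refine tendsto_inv₀_nhdsNE_zero.comp (tendsto_nhdsWithin_iff.2 ⟨hγ, ?_⟩)
  filter_upwards [Ioi_mem_atTop 0] with t ht using hγm ht

end BoundedType

theorem theorem1p2 (g h : ℂ → ℂ) (hg : g ∈ BoundedType.classB) (hh : h ∈ BoundedType.classB) :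
    (fun z : ℂ => Complex.exp (g z + h (1 / z))) ∈ BoundedType.classBStar := by
  open BoundedType in
  simp only [one_div]
  have hgd : Differentiable ℂ g := hg.1.1
  have hhd : Differentiable ℂ h := hh.1.1
  have hswap : (fun z => Complex.exp (g z⁻¹ + h z⁻¹⁻¹)) =
      fun z => Complex.exp (h z + g z⁻¹) := by
    funext z
    rw [inv_inv, add_comm]
  refine ⟨⟨fun z hz => ?_, fun z _ => Complex.exp_ne_zero _,
    isEssentialSingularity_exp_add_comp_inv hgd hh.1, ?_⟩, ?_⟩
  · exact (hasDerivAt_add_comp_inv hgd hhd hz).differentiableAt.cexp.differentiableWithinAt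
  · rw [IsEssentialSingularityAtInfty, hswap]
    exact isEssentialSingularity_exp_add_comp_inv hhd hg.1
  obtain ⟨B₁, hcrit₁, hasym₁⟩ := exists_bound_log_singular_values hg hhd
  obtain ⟨B₂, hcrit₂, hasym₂⟩ := exists_bound_log_singular_values hh hgd
  have hbound : ∀ v ∈ singPunctured fun z => Complex.exp (g z + h z⁻¹),
      ∃ b, Complex.exp b = v ∧ ‖b‖ ≤ max B₁ B₂ := by
    rintro v (⟨c, hc, hderiv, rfl⟩ | ⟨hv | hv, hv₀⟩)
    · refine ⟨_, rfl, ?_⟩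
      have hc₀ : c ≠ 0 := hc
      have hd := hasDerivAt_add_comp_inv hgd hhd hc₀
      rw [hd.cexp.deriv, mul_eq_zero, or_iff_right (Complex.exp_ne_zero _)] at hderiv
      rcases le_total 1 ‖c‖ with h₁ | h₁
      · exact (hcrit₁ c h₁ (hd.deriv.trans hderiv)).trans (le_max_left _ _)
      · -- The point `1/c` is critical for the exponent `h(z) + g(1/z)` of `f(1/z)`.
        have h := hcrit₂ c⁻¹ (by
          rw [norm_inv]
          exact (one_le_inv₀ (norm_pos_iff.2 hc₀)).2 h₁) (by
          rw [(hasDerivAt_add_comp_inv hhd hgd (inv_ne_zero hc₀)).deriv, inv_inv,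
            sub_eq_zero.1 hderiv]
          field_simp
          ring)
        rw [inv_inv, add_comm] at h
        exact h.trans (le_max_right _ _)
    · have hv' := asymptoticValues_nhds_zero_subset _ hv
      rw [hswap] at hv'
      obtain ⟨b, hb, hle⟩ := hasym₂ v hv' hv₀
      exact ⟨b, hb, hle.trans (le_max_right _ _)⟩
    · obtain ⟨b, hb, hle⟩ := hasym₁ v hv hv₀
      exact ⟨b, hb, hle.trans (le_max_left _ _)⟩
  refine ⟨Real.exp (-max B₁ B₂), Real.exp (max B₁ B₂), Real.exp_pos _, fun v hv => ?_⟩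
  obtain ⟨b, rfl, hb⟩ := hbound v hv
  rw [Complex.norm_exp, Real.exp_le_exp, Real.exp_le_exp]
  exact abs_le.1 ((Complex.abs_re_le_norm b).trans hb)
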